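/- **Setting.** A weighted pre-Courant algebroid of degree $k\ge 1$ consists of: (i) a double graded super bundle $(F,\mathrm l,\mathrm h)$, i.e. a real smooth supermanifold with two commuting smooth actions $\mathrm l,\mathrm h$ of the multiplicative monoid $(\mathbb R,\cdot)$ (homogeneity structures) of degrees $k-1$ and $2$, so that around every point there are bi-homogeneous local coordinates, on an invariant chart, of bi-weights in $\{0,\dots,k-1\}\times\{0,1,2\}$; (ii) a nondegenerate even Poisson bracket $\{\cdot,\cdot\}$ on $F$ of bi-weight $(1-k,-2)$; (iii) an odd function $\Theta\in\mathcal A^{(k-1,3)}(F)$ with $\{\{\Theta,\Theta\},f\}=0$ for all $f\in\mathcal A^{(\bullet,0)}(F)$. Here $\mathcal A^{(r,s)}(F)$ is the space of functions on $F$ that are homogeneous of weight $r$ for $\mathrm l$ and of weight $s$ for $\mathrm h$, and $\mathcal A^{(\bullet,s)}(F)=\bigoplus_{r\ge 0}\mathcal A^{(r,s)}(F)$. Put $Q_\Theta=\{\Theta,\cdot\}$ and $$H^{0,r}_{st}(F)=\{f\in\mathcal A^{(r,0)}(F): Q_\Theta f=0\},\qquad H^{0,\bullet}_{st}(F)=\{f\in\mathcal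 A^{(\bullet,0)}(F):Q_\Theta f=0\},$$ $$H^{1,\bullet}_{st}(F)=\{\Upsilon\in\mathcal A^{(\bullet,1)}(F):Q_\Theta\Upsilon=0\}\big/Q_\Theta\big(\mathcal A^{(\bullet,0)}(F)\big),$$ and let $H^{1,r}_{st}(F)\subset H^{1,\bullet}_{st}(F)$ be the space of classes of cocycles $\Upsilon\in\mathcal A^{(r,1)}(F)$. **Proposition.** Let $F$ be a weighted pre-Courant algebroid. 1. $H^{0,\bullet}_{st}(F)$ is a unital subalgebra of the algebra of functions on $F$, and it is a graded algebra: $H^{0,\bullet}_{st}(F)=\bigoplus_{r\ge0}H^{0,r}_{st}(F)$ with $H^{0,q}_{st}(F)\,H^{0,r}_{st}(F)\subset H^{0,q+r}_{st}(F)$. 2. $H^{1,\bullet}_{st}(F)$ is well defined: $Q_\Theta(\mathcal A^{(\bullet,0)}(F))$ consists of cocycles. It is graded, $H^{1,\bullet}_{st}(F)=\bigoplus_{r\ge0}H^{1,r}_{st}(F)$; moreover $Q_\Theta(\mathcal A^{(r,0)}(F))$ consists of cocycles of weight $r$, and a cocycle of weight $r$ is a coboundary if and only if it lies in $Q_\Theta(\mathcal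 A^{(r,0)}(F))$, so that $H^{1,r}_{st}(F)=\{\Upsilon\in\mathcal A^{(r,1)}(F):Q_\Theta\Upsilon=0\}/Q_\Theta(\mathcal A^{(r,0)}(F))$. 3. $f\ast[\Upsilon]=[f\,\Upsilon]$ (with $f\in H^{0,\bullet}_{st}(F)$) is well defined and makes $H^{1,\bullet}_{st}(F)$, with its given addition and real scalar multiplication, a graded module over $H^{0,\bullet}_{st}(F)$: $H^{0,q}_{st}(F)\ast H^{1,r}_{st}(F)\subset H^{1,q+r}_{st}(F)$. -/

import Mathlib

open CategoryTheory TopologicalSpace Opposite AlgebraicGeometry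
open scoped Manifold ContDiff TensorProduct DirectSum

universe u

noncomputable section

namespace PreCourant

/-! ### Superdomains -/

/-- Smooth real functions on an open subset `W` of `ℝᵐ`. -/
abbrev Smooth {m : ℕ} (W : Opens (EuclideanSpace ℝ (Fin m))) : Type :=
  C^∞⟮𝓘(ℝ, EuclideanSpace ℝ (Fin m)), W; 𝓘(ℝ, ℝ), ℝ⟯

/-- Restriction of smooth functions to a smaller open set. -/
def Smooth.restrict {m : ℕ} {W' W : Opens (EuclideanSpace ℝ (Fin m))} (h : W' ≤ W) :
    Smooth W →ₐ[ℝ] Smooth W' :=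
  { ContMDiffMap.restrictRingHom 𝓘(ℝ, EuclideanSpace ℝ (Fin m)) 𝓘(ℝ, ℝ) ℝ h with
    commutes' := fun _ => rfl }

/-- The `i`-th coordinate function on `W ⊆ ℝᵐ`. -/
def Smooth.coord {m : ℕ} (W : Opens (EuclideanSpace ℝ (Fin m))) (i : Fin m) : Smooth W :=
  ⟨fun x => x.1 i,
    ((EuclideanSpace.proj (𝕜 := ℝ) i).contDiff.contMDiff).comp
      contMDiff_subtype_val⟩

/-- The algebra of functions `C^∞(W) ⊗ Λ(ℝⁿ)` of the superdomain `W` of dimension `m|n`. -/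
abbrev SuperFun {m : ℕ} (n : ℕ) (W : Opens (EuclideanSpace ℝ (Fin m))) : Type :=
  Smooth W ⊗[ℝ] ExteriorAlgebra ℝ (Fin n → ℝ)

/-- Restriction of functions on a superdomain. -/
def SuperFun.restrict {m : ℕ} (n : ℕ) {W' W : Opens (EuclideanSpace ℝ (Fin m))} (h : W' ≤ W) :
    SuperFun n W →ₐ[ℝ] SuperFun n W' :=
  Algebra.TensorProduct.map (Smooth.restrict h) (AlgHom.id ℝ _)

/-- The parity operator of a superdomain: `+1` on even and `-1` on odd functions. -/
def SuperFun.parity {m : ℕ} (n : ℕ) (W : Opens (EuclideanSpace ℝ (Fin m))) :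
    SuperFun n W →ₐ[ℝ] SuperFun n W :=
  Algebra.TensorProduct.map (AlgHom.id ℝ (Smooth W))
    (CliffordAlgebra.involute (Q := (0 : QuadraticForm ℝ (Fin n → ℝ))))

/-- The standard even coordinates `xⁱ` and odd coordinates `ξʲ` of a superdomain. -/
def SuperFun.coord {m : ℕ} (n : ℕ) (W : Opens (EuclideanSpace ℝ (Fin m))) :
    Fin m ⊕ Fin n → SuperFun n W :=
  Sum.elim (fun i => Smooth.coord W i ⊗ₜ[ℝ] 1)
    (fun j => 1 ⊗ₜ[ℝ] ExteriorAlgebra.ι ℝ (Pi.single j 1))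

/-! ### Supermanifolds -/

/-- Topological spaces with a sheaf of (possibly noncommutative) real algebras. -/
abbrev AlgSpace : Type (u + 1) := SheafedSpace.{u + 1, u, u} (AlgCat.{u} ℝ)

/-- Sections over `U` of the structure sheaf. -/
abbrev Sec (X : AlgSpace.{u}) (U : Opens X) : Type u :=
  X.presheaf.obj (op U)

/-- Restriction of sections. -/
def res {X : AlgSpace.{u}} {V U : Opens X} (h : V ≤ U) :
    Sec X U →ₐ[ℝ] Sec X V :=
  (X.presheaf.map (homOfLE h).op).hom

/-- Pull-back of functions along a morphism, `O(U) → O(f⁻¹ U)`. -/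
def pull {X : AlgSpace.{u}} (f : X ⟶ X) (U : Opens X) :
    Sec X U →ₐ[ℝ] Sec X ((Opens.map f.hom.base).obj U) :=
  (f.hom.c.app (op U)).hom

/-- Pull-back of global functions along a morphism. -/
def pullGlobal {X : AlgSpace.{u}} (f : X ⟶ X) : Sec X ⊤ →ₐ[ℝ] Sec X ⊤ :=
  pull f ⊤

/-- A sheaf of real algebras together with its parity operator, an involutive automorphism whose
`±1` eigenspaces are the even and the odd functions. -/
structure SuperSpace where
  /-- the body with the structure sheaf -/
  space : AlgSpace.{u}
  /-- the parity operator -/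
  parity : space.presheaf ⟶ space.presheaf
  parity_parity : parity ≫ parity = 𝟙 space.presheaf

namespace SuperSpace

variable (M : SuperSpace.{u})

/-- The parity operator on sections over `U`. -/
def par (U : Opens M.space) : Sec M.space U →ₐ[ℝ] Sec M.space U :=
  (M.parity.app (op U)).hom

/-- `X` is homogeneous of Grassmann parity `a mod 2`. -/
def HasParity {U : Opens M.space} (X : Sec M.space U) (a : ℕ) : Prop :=
  M.par U X = (-1 : ℝ) ^ a • X

/-- A chart of dimension `m|n`: a homeomorphism of an open set of the body onto an open set of
`ℝᵐ`, covered by a parity preserving isomorphism of the sheaves of algebras. -/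
structure Chart (m n : ℕ) where
  /-- the body of the chart -/
  body : OpenPartialHomeomorph M.space (EuclideanSpace ℝ (Fin m))
  /-- the isomorphism of sheaves -/
  equiv : ∀ W : Opens (EuclideanSpace ℝ (Fin m)), (W : Set _) ⊆ body.target →
    SuperFun n W ≃ₐ[ℝ]
      Sec M.space ⟨body.source ∩ body ⁻¹' W, body.isOpen_inter_preimage W.isOpen⟩
  equiv_restrict : ∀ (W' W : Opens (EuclideanSpace ℝ (Fin m))) (h' : (W' : Set _) ⊆ body.target)
    (h : (W : Set _) ⊆ body.target) (hW : W' ≤ W) (φ : SuperFun n W),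
    equiv W' h' (SuperFun.restrict n hW φ) =
      res (show (⟨body.source ∩ body ⁻¹' W', body.isOpen_inter_preimage W'.isOpen⟩ : Opens M.space) ≤
        ⟨body.source ∩ body ⁻¹' W, body.isOpen_inter_preimage W.isOpen⟩ from
          fun _ hx => ⟨hx.1, hW hx.2⟩) (equiv W h φ)
  equiv_parity : ∀ (W : Opens (EuclideanSpace ℝ (Fin m))) (h : (W : Set _) ⊆ body.target)
    (φ : SuperFun n W), equiv W h (SuperFun.parity n W φ) = M.par _ (equiv W h φ)

namespace Chart

variable {M} {m n : ℕ} (c : M.Chart m n)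

/-- The image of a chart. -/
def target : Opens (EuclideanSpace ℝ (Fin m)) := ⟨c.body.target, c.body.open_target⟩

/-- The domain of a chart (all points of `c.body.source`). -/
def domain : Opens M.space :=
  ⟨c.body.source ∩ c.body ⁻¹' c.target, c.body.isOpen_inter_preimage c.target.isOpen⟩

/-- The local coordinates, even and odd, of a chart. -/
def coord (A : Fin m ⊕ Fin n) : Sec M.space c.domain :=
  c.equiv c.target subset_rfl (SuperFun.coord n c.target A)

end Chart

end SuperSpace

/-- A (real, smooth) supermanifold of dimension `m|n`. -/
structure Supermanifold (m n : ℕ) extends SuperSpace.{u} where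
  t2 : T2Space space
  secondCountable : SecondCountableTopology space
  exists_chart : ∀ p : space, ∃ c : toSuperSpace.Chart m n, p ∈ c.domain

/-! ### Double graded bundles -/

/-- An action of the multiplicative monoid `(ℝ, ·)` on a superspace: `act t` is a morphism of
superspaces, `act 1` is the identity and `act (s * t)` is the composite of `act s` and `act t`. -/
structure RealAction (M : SuperSpace.{u}) where
  /-- the action -/
  act : ℝ →* End M.space
  act_parity : ∀ (t : ℝ) (U : Opens M.space) (X : Sec M.space U),
    pull (act t) U (M.par U X) = M.par _ (pull (act t) U X)

namespace RealAction

variable {M : SuperSpace.{u}} (h : RealAction M)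

/-- The morphism `h_t`. -/
abbrev map (t : ℝ) : M.space ⟶ M.space := h.act t

/-- The function `X` on `U` satisfies `h_t^* X = t ^ w X` wherever both sides are defined. -/
def ScalesAt {U : Opens M.space} (X : Sec M.space U) (t : ℝ) (w : ℕ) : Prop :=
  res (V := U ⊓ (Opens.map (h.map t).hom.base).obj U) inf_le_right (pull (h.map t) U X) =
    t ^ w • res inf_le_left X

end RealAction

/-- A double graded (super) bundle of bi-degree `(a, b)` and dimension `m|n`: a supermanifold with
two commuting homogeneity structures `l` and `h`, i.e. actions of `(ℝ, ·)` admitting around every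
point an invariant chart with bi-homogeneous coordinates, of bi-weights at most `(a, b)`. In these
charts the actions are monomial in `t`; in particular they depend smoothly on `t ∈ ℝ`. -/
structure DoubleGradedBundle (m n a b : ℕ) extends Supermanifold.{u} m n where
  /-- the first homogeneity structure -/
  l : RealAction toSuperSpace
  /-- the second homogeneity structure -/
  h : RealAction toSuperSpace
  comm : ∀ s t : ℝ, Commute (l.act s) (h.act t)
  exists_homogeneous_chart : ∀ p : space, ∃ (c : toSuperSpace.Chart m n)
    (w : Fin m ⊕ Fin n → ℕ × ℕ), p ∈ c.domain ∧
    (∀ t : ℝ, c.domain ≤ (Opens.map (l.map t).hom.base).obj c.domain) ∧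
    (∀ t : ℝ, c.domain ≤ (Opens.map (h.map t).hom.base).obj c.domain) ∧
    ∀ A, (w A).1 ≤ a ∧ (w A).2 ≤ b ∧
      ∀ t : ℝ, l.ScalesAt (c.coord A) t (w A).1 ∧ h.ScalesAt (c.coord A) t (w A).2

/-! ### Poisson brackets -/

/-- An (even) Poisson bracket on a superspace. -/
structure PoissonBracket (M : SuperSpace.{u}) where
  /-- the bracket `{X, Y}` of functions on `U` -/
  br : ∀ U : Opens M.space, Sec M.space U →ₗ[ℝ] Sec M.space U →ₗ[ℝ] Sec M.space U
  br_res : ∀ {V U : Opens M.space} (hVU : V ≤ U) (X Y : Sec M.space U),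
    res hVU (br U X Y) = br V (res hVU X) (res hVU Y)
  br_parity : ∀ {U : Opens M.space} (X Y : Sec M.space U) (a b : ℕ),
    M.HasParity X a → M.HasParity Y b → M.HasParity (br U X Y) (a + b)
  br_skew : ∀ {U : Opens M.space} (X Y : Sec M.space U) (a b : ℕ),
    M.HasParity X a → M.HasParity Y b → br U X Y = -((-1 : ℝ) ^ (a * b) • br U Y X)
  br_leibniz : ∀ {U : Opens M.space} (X Y Z : Sec M.space U) (a b : ℕ),
    M.HasParity X a → M.HasParity Y b →
      br U X (Y * Z) = br U X Y * Z + (-1 : ℝ) ^ (a * b) • (Y * br U X Z)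
  br_jacobi : ∀ {U : Opens M.space} (X Y Z : Sec M.space U) (a b : ℕ),
    M.HasParity X a → M.HasParity Y b →
      br U X (br U Y Z) = br U (br U X Y) Z + (-1 : ℝ) ^ (a * b) • br U Y (br U X Z)

/-- In all local coordinates `x^A` of dimension `m|n` the Poisson matrix `{x^A, x^B}` is
invertible. -/
def PoissonBracket.Nondegenerate {M : SuperSpace.{u}} (P : PoissonBracket M) (m n : ℕ) : Prop :=
  ∀ c : M.Chart m n,
    IsUnit (Matrix.of fun A B : Fin m ⊕ Fin n => P.br c.domain (c.coord A) (c.coord B))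

/-! ### Weighted pre-Courant algebroids -/

namespace DoubleGradedBundle

variable {m n a b : ℕ} (F : DoubleGradedBundle.{u} m n a b)

/-- Global functions on `F`. -/
abbrev Fun : Type u := Sec F.space ⊤

/-- `A^{(r,s)}(F)`: the functions homogeneous of weight `r` for `l` and of weight `s` for `h`.
(The condition for `t = 0` would follow by continuity.) -/
def weight (r s : ℕ) : Submodule ℝ F.Fun where
  carrier := {X | ∀ t : ℝ, t ≠ 0 →
    pullGlobal (F.l.map t) X = t ^ r • X ∧ pullGlobal (F.h.map t) X = t ^ s • X}
  add_mem' := fun hX hY t ht => by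
    simp only [map_add, smul_add, (hX t ht).1, (hX t ht).2, (hY t ht).1, (hY t ht).2, and_self]
  zero_mem' := fun t _ => by simp only [map_zero, smul_zero, and_self]
  smul_mem' := fun z X hX t ht => by
    simp only [map_smul, (hX t ht).1, (hX t ht).2, smul_comm z, and_self]

/-- `A^{(•,s)}(F)`, the span of the `A^{(r,s)}(F)`, `r ≥ 0`. -/
def weightTotal (s : ℕ) : Submodule ℝ F.Fun := ⨆ r, F.weight r s

end DoubleGradedBundle

/-- A weighted pre-Courant algebroid of degree `k`, of dimension `m|n`. -/
structure WeightedPreCourantAlgebroid (m n k : ℕ) extends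
    DoubleGradedBundle.{u} m n (k - 1) 2 where
  one_le_degree : 1 ≤ k
  /-- the Poisson bracket, of bi-weight `(1 - k, -2)` -/
  poisson : PoissonBracket toSuperSpace
  nondegenerate : poisson.Nondegenerate m n
  bracket_l : ∀ (t : ℝ), t ≠ 0 → ∀ (U : Opens space) (X Y : Sec space U),
    t ^ (k - 1) • pull (l.map t) U (poisson.br U X Y) =
      poisson.br _ (pull (l.map t) U X) (pull (l.map t) U Y)
  bracket_h : ∀ (t : ℝ), t ≠ 0 → ∀ (U : Opens space) (X Y : Sec space U),
    t ^ 2 • pull (h.map t) U (poisson.br U X Y) =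
      poisson.br _ (pull (h.map t) U X) (pull (h.map t) U Y)
  /-- the pre-homological potential -/
  Θ : toDoubleGradedBundle.Fun
  Θ_odd : toSuperSpace.HasParity Θ 1
  Θ_weight : Θ ∈ toDoubleGradedBundle.weight (k - 1) 3
  Θ_almost : ∀ f ∈ toDoubleGradedBundle.weightTotal 0,
    poisson.br ⊤ (poisson.br ⊤ Θ Θ) f = 0

namespace WeightedPreCourantAlgebroid

variable {m n k : ℕ} (F : WeightedPreCourantAlgebroid.{u} m n k)

/-- Global functions on `F`. -/
abbrev Fun : Type u := F.toDoubleGradedBundle.Fun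

/-- The Hamiltonian vector field `Q = {Θ, ·}`. -/
def Q : F.Fun →ₗ[ℝ] F.Fun := F.poisson.br ⊤ F.Θ

/-- The zeroth standard cohomology: the functions in `A^{(•,0)}(F)` annihilated by `Q`. -/
def H0 : Submodule ℝ F.Fun := F.weightTotal 0 ⊓ LinearMap.ker F.Q

/-- The zeroth standard cohomology in weight `r`. -/
def H0r (r : ℕ) : Submodule ℝ F.Fun := F.weight r 0 ⊓ LinearMap.ker F.Q

/-- The first standard cocycles: elements of `A^{(•,1)}(F)` annihilated by `Q`. -/
def Z1 : Submodule ℝ F.Fun := F.weightTotal 1 ⊓ LinearMap.ker F.Q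

/-- The first standard cocycles of weight `r`. -/
def Z1r (r : ℕ) : Submodule ℝ F.Fun := F.weight r 1 ⊓ LinearMap.ker F.Q

/-- The first standard coboundaries `Q(A^{(•,0)}(F))`. -/
def B1 : Submodule ℝ F.Fun := (F.weightTotal 0).map F.Q

/-- The first standard coboundaries of weight `r`, `Q(A^{(r,0)}(F))`. -/
def B1r (r : ℕ) : Submodule ℝ F.Fun := (F.weight r 0).map F.Q

/-- The first standard cohomology: cocycles modulo coboundaries. -/
abbrev H1 : Type u := F.Z1 ⧸ F.B1.submoduleOf F.Z1

/-- The class `[Υ]` of a cocycle. -/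
def cls (Υ : F.Z1) : F.H1 := (F.B1.submoduleOf F.Z1).mkQ Υ

/-- The first standard cohomology in weight `r`: classes of cocycles of weight `r`. -/
def H1r (r : ℕ) : Submodule ℝ F.H1 :=
  ((F.Z1r r).submoduleOf F.Z1).map (F.B1.submoduleOf F.Z1).mkQ

end WeightedPreCourantAlgebroid

end PreCourant

end

/-!
The potential `Θ` is odd, so `Q = {Θ, ·}` is an odd derivation of the algebra of functions:
`Q (f g) = Q f * g + par f * Q g` for arbitrary, not necessarily parity-homogeneous, `f` and `g`
(`Q_mul`), where `par` is the parity operator. The bi-weights of the bracket and of `Θ` add up so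
that `Q` preserves the first weight and raises the second one by `1` (`map_Q_weight_le`). Finally
the Jacobi identity gives `2 Q (Q f) = {{Θ, Θ}, f}`, which vanishes for `f ∈ A^{(•,0)}(F)`
(`Q_Q_eq_zero`). The gradings and the module structure follow from these three facts.

* Spaces of distinct weights are independent, being contained in eigenspaces of the single operator
  `l₂^*` for the distinct eigenvalues `2 ^ r` (`iSupIndep_weight`). As `Q` maps weight `r` to
  weight `r`, its kernel and its image are spanned by their homogeneous elements
  (`iSup_inf_ker_of_iSupIndep`, `inf_map_iSup_of_iSupIndep`), which gives the gradings of cocycles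
  and coboundaries; the quotient of a graded space by a graded subspace is graded
  (`isInternal_map_mkQ`).
* `Q_mul` makes the kernel of `Q` closed under products, so `H⁰` is an algebra and it multiplies
  cocycles to cocycles. It also preserves coboundaries: `Q f = 0` implies `Q (par f) = 0`, and
  hence `f * Q g = Q (par f * g)` for `f` in `H⁰` (`mul_mem_B1`).
-/

/-! ### Independent families of submodules -/

section LinearAlgebra

variable {R ι V : Type*} [Ring R] [AddCommGroup V] [Module R V]

/-- If a linear map sends `W i` into `W' i` and the `W' i` are independent, then the components of
an element of its kernel lie in the kernel. -/
theorem iSup_inf_ker_of_iSupIndep {V' : Type*} [AddCommGroup V'] [Module R V']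
    {W : ι → Submodule R V} {W' : ι → Submodule R V'} (hW' : iSupIndep W') (Q : V →ₗ[R] V')
    (hQ : ∀ i, (W i).map Q ≤ W' i) :
    (⨆ i, W i) ⊓ LinearMap.ker Q = ⨆ i, W i ⊓ LinearMap.ker Q := by
  refine le_antisymm ?_ (le_inf (iSup_mono fun i => inf_le_left) (iSup_le fun i => inf_le_right))
  rintro x ⟨hx, hxQ⟩
  obtain ⟨v, hv, rfl⟩ := (Submodule.mem_iSup_iff_exists_finsupp _ _).1 hx
  have hsum : ∑ i ∈ v.support, Q (v i) = 0 := by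
    rw [← map_sum]
    exact hxQ
  have hzero := (iSupIndep_iff_finsetSum_eq_zero_imp_eq_zero W').1 hW' v.support
    (fun i => Q (v i)) (fun i _ => hQ i (Submodule.mem_map_of_mem (hv i))) hsum
  exact Submodule.sum_mem _ fun i hi => Submodule.mem_iSup_of_mem i ⟨hv i, hzero i hi⟩

/-- The part of degree `i` of the span of subspaces of the members of an independent family. -/
theorem inf_iSup_of_iSupIndep {A W : ι → Submodule R V} (hW : iSupIndep W)
    (hA : ∀ i, A i ≤ W i) (i : ι) : W i ⊓ ⨆ j, A j = A i := by
  classical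
  have hsplit : ⨆ j, A j = A i ⊔ ⨆ (j) (_ : j ≠ i), A j := by
    refine le_antisymm (iSup_le fun j => ?_)
      (sup_le (le_iSup A i) (iSup₂_le fun j _ => le_iSup A j))
    by_cases h : j = i
    · subst h
      exact le_sup_left
    · exact le_sup_of_le_right (le_iSup₂_of_le j h le_rfl)
  have hdisj : (⨆ (j) (_ : j ≠ i), A j) ⊓ W i = ⊥ :=
    ((hW i).mono_right (iSup₂_mono fun j _ => hA j)).symm.eq_bot
  rw [hsplit, inf_comm, sup_inf_assoc_of_le _ (hA i), hdisj, sup_bot_eq]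

theorem inf_map_iSup_of_iSupIndep {V' : Type*} [AddCommGroup V'] [Module R V']
    {W : ι → Submodule R V} {W' : ι → Submodule R V'} (hW' : iSupIndep W') (Q : V →ₗ[R] V')
    (hQ : ∀ i, (W i).map Q ≤ W' i) (i : ι) :
    W' i ⊓ (⨆ j, W j).map Q = (W i).map Q := by
  rw [Submodule.map_iSup]
  exact inf_iSup_of_iSupIndep hW' hQ i

theorem iSup_comap_eq_top {V' : Type*} [AddCommGroup V'] [Module R V'] {j : V' →ₗ[R] V}
    (hj : Function.Injective j) {W : ι → Submodule R V} (hrange : LinearMap.range j = ⨆ i, W i) :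
    ⨆ i, (W i).comap j = ⊤ := by
  have hmap : ∀ i, ((W i).comap j).map j = W i := fun i =>
    Submodule.map_comap_eq_of_le (hrange ▸ le_iSup W i)
  rw [← Submodule.comap_iSup_map_of_injective hj]
  simp only [hmap, ← hrange]
  exact Submodule.comap_map_eq_of_injective hj ⊤ ▸ by rw [LinearMap.range_eq_map]

theorem isInternal_comap_of_iSupIndep [DecidableEq ι] {V' : Type*} [AddCommGroup V'] [Module R V']
    {j : V' →ₗ[R] V} (hj : Function.Injective j) {W : ι → Submodule R V} (hW : iSupIndep W)
    (hrange : LinearMap.range j = ⨆ i, W i) :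
    DirectSum.IsInternal fun i => (W i).comap j := by
  refine DirectSum.isInternal_submodule_of_iSupIndep_of_iSup_eq_top ?_
    (iSup_comap_eq_top hj hrange)
  rw [iSupIndep_iff_finsetSum_eq_zero_imp_eq_zero] at hW ⊢
  intro s v hv hsum i hi
  refine hj ((hW s (fun i => j (v i)) hv ?_ i hi).trans (map_zero j).symm)
  rw [← map_sum, hsum, map_zero]

/-- The quotient of a graded module by a homogeneous submodule is graded. -/
theorem isInternal_map_mkQ [DecidableEq ι] {Z : ι → Submodule R V}
    (hZ : DirectSum.IsInternal Z) {B : Submodule R V} (hB : B ≤ ⨆ i, Z i ⊓ B) :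
    DirectSum.IsInternal fun i => (Z i).map B.mkQ := by
  obtain ⟨hind, htop⟩ := (DirectSum.isInternal_submodule_iff_iSupIndep_and_iSup_eq_top Z).1 hZ
  refine DirectSum.isInternal_submodule_of_iSupIndep_of_iSup_eq_top (fun i => ?_) ?_
  · simp only [← Submodule.map_iSup]
    rw [Submodule.disjoint_def]
    rintro _ ⟨x, hx, rfl⟩ ⟨y, hy, hxy⟩
    have hmem : x - y ∈ B := by
      rw [← Submodule.Quotient.eq]
      exact hxy.symm
    have hsplit : x - y ∈ (Z i ⊓ B) ⊔ ⨆ (j) (_ : j ≠ i), Z j := by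
      refine (hB.trans (iSup_le fun j => ?_)) hmem
      by_cases h : j = i
      · subst h
        exact le_sup_left
      · exact le_sup_of_le_right (inf_le_left.trans (le_iSup₂_of_le j h le_rfl))
    obtain ⟨b, hb, c, hc, hbc⟩ := Submodule.mem_sup.1 hsplit
    -- `x - b = y + c` lies both in `Z i` and in the span of the other `Z j`.
    have hxb : x - b = 0 := by
      refine Submodule.disjoint_def.1 (hind i) _ (sub_mem hx hb.1) ?_
      have : x - b = y + c := by
        rw [sub_eq_iff_eq_add, add_assoc, add_comm c b, hbc, add_sub_cancel]
      exact this ▸ add_mem hy hc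
    rw [Submodule.mkQ_apply, Submodule.Quotient.mk_eq_zero, sub_eq_zero.1 hxb]
    exact hb.2
  · rw [← Submodule.map_iSup, htop, Submodule.map_top, Submodule.range_mkQ]

end LinearAlgebra

namespace PreCourant

/-! ### The parity operator -/

namespace SuperSpace

variable (M : SuperSpace.{u})

theorem par_par (U : Opens M.space) (X : Sec M.space U) : M.par U (M.par U X) = X := by
  have h := congrArg (fun η => (η.app (op U)).hom X) M.parity_parity
  exact h

variable {M}

theorem par_eq_neg_of_odd {U : Opens M.space} {X : Sec M.space U} (h : M.HasParity X 1) :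
    M.par U X = -X := by
  rw [HasParity] at h
  rw [h, pow_one, neg_smul, one_smul]

/-- An additive property of functions may be checked on even and on odd functions. -/
theorem parity_induction {U : Opens M.space} {p : Sec M.space U → Prop}
    (even : ∀ X, M.HasParity X 0 → p X) (odd : ∀ X, M.HasParity X 1 → p X)
    (add : ∀ X Y, p X → p Y → p (X + Y)) (X : Sec M.space U) : p X := by
  have hX : X = (2⁻¹ : ℝ) • (X + M.par U X) + (2⁻¹ : ℝ) • (X - M.par U X) := by
    rw [← smul_add, add_add_sub_cancel, ← two_smul ℝ X, smul_smul]
    norm_num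
  rw [hX]
  refine add _ _ (even _ ?_) (odd _ ?_)
  · rw [HasParity, map_smul, map_add, par_par, pow_zero, one_smul, add_comm]
  · rw [HasParity, map_smul, map_sub, par_par, pow_one, neg_smul, one_smul, ← smul_neg, neg_sub]

end SuperSpace

/-! ### Functions homogeneous of a given bi-weight -/

namespace DoubleGradedBundle

variable {m n a b : ℕ} (F : DoubleGradedBundle.{u} m n a b)

theorem one_mem_weight : (1 : F.Fun) ∈ F.weight 0 0 := fun t _ => by simp

variable {F} in
theorem mul_mem_weight {q r s s' : ℕ} {f g : F.Fun} (hf : f ∈ F.weight q s)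
    (hg : g ∈ F.weight r s') : f * g ∈ F.weight (q + r) (s + s') := fun t ht => by
  simp only [map_mul, (hf t ht).1, (hf t ht).2, (hg t ht).1, (hg t ht).2, smul_mul_smul_comm,
    ← pow_add, and_self]

variable {F} in
theorem mul_mem_weightTotal {s s' : ℕ} {f g : F.Fun} (hf : f ∈ F.weightTotal s)
    (hg : g ∈ F.weightTotal s') : f * g ∈ F.weightTotal (s + s') := by
  refine (show F.weightTotal s * F.weightTotal s' ≤ F.weightTotal (s + s') from ?_)
    (Submodule.mul_mem_mul hf hg)
  simp only [weightTotal, Submodule.iSup_mul, Submodule.mul_iSup]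
  exact iSup_le fun r => iSup_le fun q => Submodule.mul_le.2 fun f hf g hg =>
    Submodule.mem_iSup_of_mem (q + r) (mul_mem_weight hf hg)

variable {F} in
theorem par_mem_weight {r s : ℕ} {f : F.Fun} (hf : f ∈ F.weight r s) :
    F.par ⊤ f ∈ F.weight r s := fun t ht => by
  have hl : pullGlobal (F.l.map t) (F.par ⊤ f) = F.par ⊤ (pullGlobal (F.l.map t) f) :=
    F.l.act_parity t ⊤ f
  have hh : pullGlobal (F.h.map t) (F.par ⊤ f) = F.par ⊤ (pullGlobal (F.h.map t) f) :=
    F.h.act_parity t ⊤ f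
  rw [hl, hh, (hf t ht).1, (hf t ht).2, map_smul, map_smul]
  exact ⟨rfl, rfl⟩

variable {F} in
theorem par_mem_weightTotal {s : ℕ} {f : F.Fun} (hf : f ∈ F.weightTotal s) :
    F.par ⊤ f ∈ F.weightTotal s := by
  have h : F.weightTotal s ≤ (F.weightTotal s).comap (F.par ⊤).toLinearMap :=
    iSup_le fun r f hf => Submodule.mem_iSup_of_mem r (par_mem_weight hf)
  exact h hf

/-- Functions of distinct first weights are eigenvectors of `l₂^*` for distinct eigenvalues. -/
theorem iSupIndep_weight (s : ℕ) : iSupIndep fun r => F.weight r s := by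
  have hinj : Function.Injective fun r : ℕ => (2 : ℝ) ^ r :=
    pow_right_injective₀ two_pos (by norm_num)
  refine ((Module.End.eigenspaces_iSupIndep
    (pullGlobal (F.l.map 2)).toLinearMap).comp hinj).mono fun r f hf => ?_
  exact Module.End.mem_eigenspace_iff.2 (hf 2 two_ne_zero).1

end DoubleGradedBundle

/-! ### The Hamiltonian vector field -/

namespace WeightedPreCourantAlgebroid

variable {m n k : ℕ} {F : WeightedPreCourantAlgebroid.{u} m n k}

theorem Q_mem_weight {r s : ℕ} {f : F.Fun} (hf : f ∈ F.weight r s) :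
    F.Q f ∈ F.weight r (s + 1) := fun t ht => by
  have hl : t ^ (k - 1) • pullGlobal (F.l.map t) (F.Q f) =
      F.poisson.br ⊤ (pullGlobal (F.l.map t) F.Θ) (pullGlobal (F.l.map t) f) :=
    F.bracket_l t ht ⊤ F.Θ f
  have hh : t ^ 2 • pullGlobal (F.h.map t) (F.Q f) =
      F.poisson.br ⊤ (pullGlobal (F.h.map t) F.Θ) (pullGlobal (F.h.map t) f) :=
    F.bracket_h t ht ⊤ F.Θ f
  rw [(F.Θ_weight t ht).1, (hf t ht).1, LinearMap.map_smul₂, map_smul] at hl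
  rw [(F.Θ_weight t ht).2, (hf t ht).2, LinearMap.map_smul₂, map_smul, smul_smul,
    ← pow_add, show 3 + s = 2 + (s + 1) by omega, pow_add, ← smul_smul] at hh
  exact ⟨smul_right_injective _ (pow_ne_zero _ ht) hl, smul_right_injective _ (pow_ne_zero _ ht) hh⟩

variable (F) in
theorem map_Q_weight_le (s r : ℕ) : (F.weight r s).map F.Q ≤ F.weight r (s + 1) :=
  Submodule.map_le_iff_le_comap.2 fun _ hf => Q_mem_weight hf

/-- `Q` is a derivation of odd parity; the sign is expressed by the parity operator. -/
theorem Q_mul (f g : F.Fun) : F.Q (f * g) = F.Q f * g + F.par ⊤ f * F.Q g := by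
  induction f using SuperSpace.parity_induction (M := F.toSuperSpace) with
  | even f hf =>
    have h := F.poisson.br_leibniz F.Θ f g 1 0 F.Θ_odd hf
    rw [SuperSpace.HasParity, pow_zero, one_smul] at hf
    rw [mul_zero, pow_zero, one_smul] at h
    rw [hf]
    exact h
  | odd f hf =>
    have h := F.poisson.br_leibniz F.Θ f g 1 1 F.Θ_odd hf
    rw [mul_one, pow_one, neg_smul, one_smul, ← neg_mul] at h
    rw [SuperSpace.par_eq_neg_of_odd hf]
    exact h
  | add f f' hf hf' =>
    rw [add_mul, map_add, hf, hf', map_add, map_add, add_mul, add_mul, add_add_add_comm]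

theorem Q_par (f : F.Fun) : F.Q (F.par ⊤ f) = -F.par ⊤ (F.Q f) := by
  induction f using SuperSpace.parity_induction (M := F.toSuperSpace) with
  | even f hf =>
    have h := SuperSpace.par_eq_neg_of_odd (F.poisson.br_parity F.Θ f 1 0 F.Θ_odd hf)
    rw [SuperSpace.HasParity, pow_zero, one_smul] at hf
    rw [hf, show F.par ⊤ (F.Q f) = -F.Q f from h, neg_neg]
  | odd f hf =>
    have h : F.par ⊤ (F.Q f) = _ := F.poisson.br_parity F.Θ f 1 1 F.Θ_odd hf
    rw [SuperSpace.par_eq_neg_of_odd hf, map_neg, h, one_add_one_eq_two, neg_one_sq, one_smul]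
    rfl
  | add f f' hf hf' => rw [map_add, map_add, hf, hf', map_add, map_add, neg_add]

theorem Q_mul_eq_zero {f g : F.Fun} (hf : F.Q f = 0) (hg : F.Q g = 0) : F.Q (f * g) = 0 := by
  rw [Q_mul, hf, hg, zero_mul, mul_zero, add_zero]

theorem Q_one : F.Q 1 = 0 := by
  simpa using Q_mul (F := F) 1 1

/-- By the Jacobi identity `2 Q² = {{Θ, Θ}, ·}`. -/
theorem Q_Q_eq_zero {f : F.Fun} (hf : f ∈ F.weightTotal 0) : F.Q (F.Q f) = 0 := by
  -- The identity involves the parities of the first two entries only, here both equal to `Θ`.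
  have h := F.poisson.br_jacobi F.Θ F.Θ f 1 1 F.Θ_odd F.Θ_odd
  rw [F.Θ_almost f hf, zero_add, mul_one, pow_one, neg_smul, one_smul] at h
  have h2 : (2 : ℝ) • F.Q (F.Q f) = 0 := by
    rw [two_smul]
    exact add_eq_zero_iff_eq_neg.2 h
  exact (smul_eq_zero.1 h2).resolve_left two_ne_zero

/-! ### Cocycles and coboundaries -/

variable (F)

theorem H0_eq_iSup : F.H0 = ⨆ r, F.H0r r :=
  iSup_inf_ker_of_iSupIndep (F.iSupIndep_weight 1) F.Q (F.map_Q_weight_le 0)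

theorem Z1_eq_iSup : F.Z1 = ⨆ r, F.Z1r r :=
  iSup_inf_ker_of_iSupIndep (F.iSupIndep_weight 2) F.Q (F.map_Q_weight_le 1)

theorem B1_eq_iSup : F.B1 = ⨆ r, F.B1r r := Submodule.map_iSup _ _

theorem B1r_le_Z1r (r : ℕ) : F.B1r r ≤ F.Z1r r := by
  rintro _ ⟨f, hf, rfl⟩
  exact ⟨Q_mem_weight hf, Q_Q_eq_zero (Submodule.mem_iSup_of_mem r hf)⟩

theorem B1_le_Z1 : F.B1 ≤ F.Z1 := by
  rw [B1_eq_iSup, Z1_eq_iSup]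
  exact iSup_mono F.B1r_le_Z1r

theorem Z1r_inf_B1 (r : ℕ) : F.Z1r r ⊓ F.B1 = F.B1r r := by
  refine le_antisymm ?_ (le_inf (F.B1r_le_Z1r r) (F.B1_eq_iSup ▸ le_iSup F.B1r r))
  rw [B1r, ← inf_map_iSup_of_iSupIndep (F.iSupIndep_weight 1) F.Q (F.map_Q_weight_le 0) r]
  exact inf_le_inf_right _ inf_le_left

theorem isInternal_Z1r : DirectSum.IsInternal fun r => (F.Z1r r).submoduleOf F.Z1 :=
  isInternal_comap_of_iSupIndep F.Z1.injective_subtype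
    ((F.iSupIndep_weight 1).mono fun _ => inf_le_left)
    (F.Z1.range_subtype.trans F.Z1_eq_iSup)

theorem isInternal_H1r : DirectSum.IsInternal F.H1r := by
  refine isInternal_map_mkQ F.isInternal_Z1r fun x hx => ?_
  have hle : ⨆ r, F.B1r r ≤
      (⨆ r, (F.Z1r r).submoduleOf F.Z1 ⊓ F.B1.submoduleOf F.Z1).map F.Z1.subtype := by
    rw [Submodule.map_iSup]
    refine iSup_mono fun r y hy => ?_
    have hyZ : y ∈ F.Z1r r ⊓ F.B1 := (F.Z1r_inf_B1 r).symm ▸ hy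
    exact ⟨⟨y, F.B1_le_Z1 hyZ.2⟩, hyZ, rfl⟩
  obtain ⟨y, hy, hyx⟩ := hle (F.B1_eq_iSup ▸ (show (x : F.Fun) ∈ F.B1 from hx))
  exact F.Z1.injective_subtype hyx ▸ hy

/-! ### The algebra of degree zero and its action in degree one -/

theorem one_mem_H0 : (1 : F.Fun) ∈ F.H0 :=
  ⟨Submodule.mem_iSup_of_mem 0 F.one_mem_weight, Q_one⟩

variable {F} in
theorem mul_mem_H0 {f g : F.Fun} (hf : f ∈ F.H0) (hg : g ∈ F.H0) : f * g ∈ F.H0 := by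
  have h := DoubleGradedBundle.mul_mem_weightTotal hf.1 hg.1
  rw [zero_add] at h
  exact ⟨h, Q_mul_eq_zero hf.2 hg.2⟩

/-- The zeroth standard cohomology as a unital algebra. -/
def H0Subalgebra : Subalgebra ℝ F.Fun :=
  F.H0.toSubalgebra F.one_mem_H0 fun _ _ => mul_mem_H0

theorem toSubmodule_H0Subalgebra : Subalgebra.toSubmodule F.H0Subalgebra = F.H0 :=
  Submodule.toSubalgebra_toSubmodule _ _ _

theorem nonempty_gradedAlgebra_H0Subalgebra :
    Nonempty (GradedAlgebra fun r => (F.H0r r).comap F.H0Subalgebra.val.toLinearMap) := by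
  have hint : DirectSum.IsInternal fun r => (F.H0r r).comap F.H0Subalgebra.val.toLinearMap := by
    refine isInternal_comap_of_iSupIndep Subtype.val_injective
      ((F.iSupIndep_weight 0).mono fun _ => inf_le_left) ?_
    rw [← H0_eq_iSup, ← toSubmodule_H0Subalgebra]
    exact Submodule.range_subtype (Subalgebra.toSubmodule F.H0Subalgebra)
  refine ⟨{ hint.chooseDecomposition with
    one_mem := ⟨F.one_mem_weight, Q_one⟩
    mul_mem := fun q r f g hf hg =>
      ⟨DoubleGradedBundle.mul_mem_weight hf.1 hg.1, (f * g).2.2⟩ }⟩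

variable {F}

theorem mul_mem_Z1 {f Υ : F.Fun} (hf : f ∈ F.H0) (hΥ : Υ ∈ F.Z1) : f * Υ ∈ F.Z1 := by
  have h := DoubleGradedBundle.mul_mem_weightTotal hf.1 hΥ.1
  rw [zero_add] at h
  exact ⟨h, Q_mul_eq_zero hf.2 hΥ.2⟩

theorem mul_mem_B1 {f Υ : F.Fun} (hf : f ∈ F.H0) (hΥ : Υ ∈ F.B1) : f * Υ ∈ F.B1 := by
  obtain ⟨g, hg, rfl⟩ := hΥ
  have h := DoubleGradedBundle.mul_mem_weightTotal
    (DoubleGradedBundle.par_mem_weightTotal hf.1) hg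
  refine ⟨F.par ⊤ f * g, h, ?_⟩
  rw [Q_mul, Q_par, LinearMap.mem_ker.1 hf.2, map_zero, neg_zero, zero_mul, zero_add,
    SuperSpace.par_par]

/-- Multiplication of cocycles by an element of the zeroth cohomology. -/
def mulZ1 (f : F.H0Subalgebra) : F.Z1 →ₗ[ℝ] F.Z1 :=
  (LinearMap.mulLeft ℝ (f : F.Fun)).restrict fun _ hΥ => mul_mem_Z1 f.2 hΥ

/-- The action `f ∗ [Υ] = [f Υ]` of the zeroth cohomology on the first. -/
def mulH1 (f : F.H0Subalgebra) : F.H1 →ₗ[ℝ] F.H1 :=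
  Submodule.mapQ _ _ (mulZ1 f) fun _ hΥ => mul_mem_B1 f.2 hΥ

variable (F) in
/-- The first standard cohomology as a module over the zeroth. -/
@[reducible]
def moduleH1 : Module F.H0Subalgebra F.H1 where
  smul f x := mulH1 f x
  one_smul x := by
    induction x using Submodule.Quotient.induction_on with
    | H Υ => exact congrArg F.cls (Subtype.ext (one_mul (Υ : F.Fun)))
  mul_smul f g x := by
    induction x using Submodule.Quotient.induction_on with
    | H Υ => exact congrArg F.cls (Subtype.ext (mul_assoc (f : F.Fun) g Υ))
  smul_zero f := map_zero (mulH1 f)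
  smul_add f := map_add (mulH1 f)
  add_smul f g x := by
    induction x using Submodule.Quotient.induction_on with
    | H Υ => exact congrArg F.cls (Subtype.ext (add_mul (f : F.Fun) g Υ))
  zero_smul x := by
    induction x using Submodule.Quotient.induction_on with
    | H Υ => exact congrArg F.cls (Subtype.ext (zero_mul (Υ : F.Fun)))

end WeightedPreCourantAlgebroid

end PreCourant

open PreCourant WeightedPreCourantAlgebroid in
theorem mainTheorem11 {m n k : ℕ} (F : PreCourant.WeightedPreCourantAlgebroid.{u} m n k) :
    ∃ H : Subalgebra ℝ F.Fun, Subalgebra.toSubmodule H = F.H0 ∧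
      Nonempty (GradedAlgebra fun r => (F.H0r r).comap H.val.toLinearMap) ∧
      F.B1 ≤ F.Z1 ∧
      (∀ r, F.B1r r ≤ F.Z1r r ∧ F.Z1r r ⊓ F.B1 = F.B1r r) ∧
      DirectSum.IsInternal F.H1r ∧
      ∃ inst : Module H F.H1,
        (∀ (f : H) (Υ : F.Z1), ∃ hf : (f : F.Fun) * (Υ : F.Fun) ∈ F.Z1,
          f • F.cls Υ = F.cls ⟨(f : F.Fun) * (Υ : F.Fun), hf⟩) ∧
        IsScalarTower ℝ H F.H1 ∧
        ∀ (q r : ℕ) (f : H) (x : F.H1), (f : F.Fun) ∈ F.H0r q → x ∈ F.H1r r →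
          f • x ∈ F.H1r (q + r) := by
  let := F.moduleH1
  refine ⟨F.H0Subalgebra, F.toSubmodule_H0Subalgebra, F.nonempty_gradedAlgebra_H0Subalgebra,
    F.B1_le_Z1, fun r => ⟨F.B1r_le_Z1r r, F.Z1r_inf_B1 r⟩, F.isInternal_H1r, F.moduleH1,
    fun f Υ => ⟨mul_mem_Z1 f.2 Υ.2, rfl⟩, ⟨fun t f x => ?_⟩, ?_⟩
  · induction x using Submodule.Quotient.induction_on with
    | H Υ => exact congrArg F.cls (Subtype.ext (smul_mul_assoc t (f : F.Fun) (Υ : F.Fun)))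
  · rintro q r f _ hf ⟨Υ, hΥ, rfl⟩
    refine ⟨mulZ1 f Υ, ⟨?_, (mulZ1 f Υ).2.2⟩, rfl⟩
    have h := DoubleGradedBundle.mul_mem_weight hf.1 hΥ.1
    rwa [zero_add] at h
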